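/- Let $\alpha\in(0,2]$ and $\nu>0$. Let $X_1,X_2,\ldots$ be independent (not necessarily identically distributed) random variables with $\mathsf{E}X_i=0$ and $0<\sigma_i^2=\mathsf{Var}X_i<\infty$. Put $S^*_k=X_1+\ldots+X_k$ and $B_k^2=\sigma_1^2+\ldots+\sigma_k^2$ (with $S^*_0=B_0^2=0$), and assume the Lindeberg condition: for every $\tau>0$, $$\lim_{n\to\infty}\frac1{B_n^2}\sum_{i=1}^n\int_{|x|\ge\tau B_n}x^2\,d\mathsf{P}(X_i<x)=0.$$ Let $N_1,N_2,\ldots$ be random variables on the same probability space with values in $\{0,1,2,\ldots\}$ such that, for each $n$, $N_n$ is independent of the sequence $X_1,X_2,\ldots$, and such that $N_n\to\infty$ in probability, that is, $\mathsf{P}(N_n\le m)\to0$ for every $m\in(0,\infty)$. Let $d_n>0$ be any sequence of numbers with $d_n\to\infty$. Denote by $L_{\alpha,\nu}$ a random variable with the generalized Linnik distribution, i.e. with characteristic function $t\mapsto(1+|t|^\alpha)^{-\nu}$, $t\in\mathbb{R}$, and by $M_{\alpha/2,\nu}$ a nonnegative random variable with the generalized Mittag-Leffler distribution, i.e. with Laplace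 transform $\mathsf{E}e^{-sM_{\alpha/2,\nu}}=(1+s^{\alpha/2})^{-\nu}$, $s\ge0$. Then, with $\Longrightarrow$ denoting convergence in distribution as $n\to\infty$, $$\frac{S^*_{N_n}}{d_n}\Longrightarrow L_{\alpha,\nu}\quad\text{if and only if}\quad\frac{B^2_{N_n}}{d_n^2}\Longrightarrow 2M_{\alpha/2,\nu}.$$ -/

import Mathlib

open MeasureTheory ProbabilityTheory Filter Topology

/-- `μ` is the (symmetric) generalized Linnik law with parameters `α` and `ν`: the probability
measure on `ℝ` with characteristic function `t ↦ 1 / (1 + |t| ^ α) ^ ν`. -/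
def IsGeneralizedLinnik (α ν : ℝ) (μ : ProbabilityMeasure ℝ) : Prop :=
  ∀ t : ℝ, charFun (μ : Measure ℝ) t = ((1 / (1 + |t| ^ α) ^ ν : ℝ) : ℂ)

/-- `μ` is the generalized Mittag-Leffler law with parameters `δ` and `ν`: the probability measure
concentrated on the nonnegative half-line with Laplace transform `s ↦ 1 / (1 + s ^ δ) ^ ν`,
`s ≥ 0`. -/
def IsGeneralizedMittagLeffler (δ ν : ℝ) (μ : ProbabilityMeasure ℝ) : Prop :=
  (∀ᵐ x ∂(μ : Measure ℝ), 0 ≤ x) ∧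
    ∀ s : ℝ, 0 ≤ s → ∫ x, Real.exp (-(s * x)) ∂(μ : Measure ℝ) = 1 / (1 + s ^ δ) ^ ν

/-- The partial sum of the first `k` terms of the sequence `X 0, X 1, …` (zero for `k = 0`). -/
noncomputable def partialSum {Ω : Type*} (X : ℕ → Ω → ℝ) (k : ℕ) (ω : Ω) : ℝ :=
  ∑ i ∈ Finset.range k, X i ω

/-- The sum `B_k ^ 2` of the variances of the first `k` terms of the sequence `X 0, X 1, …`. -/
noncomputable def varSum {Ω : Type*} [MeasurableSpace Ω] (P : Measure Ω) (X : ℕ → Ω → ℝ)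
    (k : ℕ) : ℝ :=
  ∑ i ∈ Finset.range k, variance (X i) P

/-- The Lindeberg condition: for every `τ > 0`,
`B_n ^ (-2) * ∑ i < n, ∫_{|x| ≥ τ B_n} x ^ 2 dP(X_i < x) → 0`. -/
def LindebergCondition {Ω : Type*} [MeasurableSpace Ω] (P : Measure Ω) (X : ℕ → Ω → ℝ) : Prop :=
  ∀ τ : ℝ, 0 < τ →
    Tendsto (fun n : ℕ => 1 / varSum P X n *
      ∑ i ∈ Finset.range n,
        ∫ x in {x : ℝ | τ * √(varSum P X n) ≤ |x|}, x ^ 2 ∂(P.map (X i)))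
      atTop (𝓝 0)

/-- `N n → ∞` in probability. -/
def TendstoInProbabilityAtTop {Ω : Type*} [MeasurableSpace Ω] (P : Measure Ω)
    (N : ℕ → Ω → ℕ) : Prop :=
  ∀ m : ℝ, 0 < m → Tendsto (fun n : ℕ => P {ω | (N n ω : ℝ) ≤ m}) atTop (𝓝 0)

/-! Given `N n = k`, the sum is approximately normal with variance B_k², so the characteristic
function of S*_{N_n}/d_n at t is close to E exp(-(t²/2)·B²_{N_n}/d_n²), the Laplace transform of the
random variance at t²/2. The limits match in the same way: (1+|t|^α)^{-ν} is the Laplace transform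
of 2M at t²/2.

The replacement is `tendsto_charFun_randomSum_sub_integral_exp`. It needs only tightness of
B²_{N_n}/d_n², because the CLT error is uniform on |u|·B_k ≤ R
(`exists_forall_norm_charFun_partialSum_sub_exp_le`). From right to left, tightness comes with the
assumed convergence, and Lévy's theorem concludes. From left to right it must be extracted from the
sums: by the CLT, |S*_k| > B_k has probability at least some c > 0 for large k, so large variances
force large sums (`exists_eventually_measureReal_lt_varSum_le`). The continuity theorem for Laplace
transforms then gives the limit. -/

/-! ### Taylor estimates and product comparison -/

theorem norm_exp_mul_I_sub_taylor_le (x : ℝ) :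
    ‖Complex.exp (x * Complex.I) - 1 - x * Complex.I + (x : ℂ) ^ 2 / 2‖ ≤ 3 * |x| ^ 3 ∧
    ‖Complex.exp (x * Complex.I) - 1 - x * Complex.I + (x : ℂ) ^ 2 / 2‖ ≤ 3 * x ^ 2 := by
  have hn : ‖(x : ℂ) * Complex.I‖ = |x| := by simp
  rcases le_total |x| 1 with h | h
  · have h3 := Complex.exp_bound (x := x * Complex.I) (by rwa [hn]) (n := 3) (by norm_num)
    have e : Complex.exp (x * Complex.I) - ∑ m ∈ Finset.range 3, (x * Complex.I) ^ m / m.factorial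
        = Complex.exp (x * Complex.I) - 1 - x * Complex.I + (x : ℂ) ^ 2 / 2 := by
      simp [Finset.sum_range_succ, mul_pow]
      ring
    rw [e, hn] at h3
    norm_num [Nat.factorial] at h3
    have hx : |x| ^ 3 ≤ x ^ 2 := by
      rw [← sq_abs x]; nlinarith [sq_nonneg |x|]
    have := pow_nonneg (abs_nonneg x) 3
    constructor <;> linarith
  · have h1 : ‖Complex.exp (x * Complex.I) - 1‖ ≤ |x| := by
      have := Real.norm_exp_I_mul_ofReal_sub_one_le (x := x)
      rwa [mul_comm, Real.norm_eq_abs] at this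
    have h2 : ‖Complex.exp (x * Complex.I) - 1 - x * Complex.I + (x : ℂ) ^ 2 / 2‖
        ≤ |x| + |x| + |x| ^ 2 / 2 := by
      refine (norm_add_le _ _).trans (add_le_add ((norm_sub_le _ _).trans (add_le_add h1 hn.le)) ?_)
      simp
    have h3 : |x| ≤ |x| ^ 2 := by nlinarith
    have h4 : |x| ^ 2 ≤ |x| ^ 3 := by nlinarith [sq_nonneg |x|]
    rw [← sq_abs x]
    constructor <;> linarith

/-- Integrate the cubic remainder bound over |x| < c, where |x|³ ≤ c x², and the quadratic one over
the tail. No third moment is needed. -/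
theorem norm_charFun_sub_taylor_le {μ : Measure ℝ} [IsProbabilityMeasure μ] (hL : MemLp id 2 μ)
    (hm : ∫ x, x ∂μ = 0) {c : ℝ} (hc : 0 ≤ c) (t : ℝ) :
    ‖charFun μ t - (1 - t ^ 2 * ((∫ x, x ^ 2 ∂μ : ℝ) : ℂ) / 2)‖ ≤
      3 * |t| ^ 3 * c * (∫ x, x ^ 2 ∂μ) + 3 * t ^ 2 * ∫ x in {x : ℝ | c ≤ |x|}, x ^ 2 ∂μ := by
  have i1 : Integrable (fun x : ℝ => x) μ := hL.integrable (by norm_num)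
  have i2 : Integrable (fun x : ℝ => x ^ 2) μ := hL.integrable_sq
  have i1c : Integrable (fun x : ℝ => (x : ℂ)) μ := i1.ofReal
  have i2c : Integrable (fun x : ℝ => ((x ^ 2 : ℝ) : ℂ)) μ := i2.ofReal
  have ie : Integrable (fun x : ℝ => Complex.exp (((t * x : ℝ) : ℂ) * Complex.I)) μ := by
    refine Integrable.of_bound (by fun_prop) 1 (ae_of_all _ fun x => ?_)
    rw [Complex.norm_exp_ofReal_mul_I]
  have hs : MeasurableSet {x : ℝ | c ≤ |x|} := measurableSet_le measurable_const (by fun_prop)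
  have key : charFun μ t - (1 - t ^ 2 * ((∫ x, x ^ 2 ∂μ : ℝ) : ℂ) / 2) =
      ∫ x : ℝ, (Complex.exp (((t * x : ℝ) : ℂ) * Complex.I) - 1 - ((t * x : ℝ) : ℂ) * Complex.I
        + ((t * x : ℝ) : ℂ) ^ 2 / 2) ∂μ := by
    have e : ∀ x : ℝ, (Complex.exp (((t * x : ℝ) : ℂ) * Complex.I) - 1
        - ((t * x : ℝ) : ℂ) * Complex.I + ((t * x : ℝ) : ℂ) ^ 2 / 2) =
        (Complex.exp (((t * x : ℝ) : ℂ) * Complex.I) - 1 - (t * Complex.I) * (x : ℂ))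
          + (t ^ 2 / 2) * ((x ^ 2 : ℝ) : ℂ) := by
      intro x; push_cast; ring
    have ie1 : Integrable (fun x : ℝ => Complex.exp (((t * x : ℝ) : ℂ) * Complex.I) - 1) μ :=
      ie.sub (integrable_const _)
    have ie2 : Integrable (fun x : ℝ => Complex.exp (((t * x : ℝ) : ℂ) * Complex.I) - 1
        - (t * Complex.I) * (x : ℂ)) μ := ie1.sub (i1c.const_mul _)
    simp_rw [e]
    rw [integral_add ie2 (i2c.const_mul _), integral_sub ie1 (i1c.const_mul _),
      integral_sub ie (integrable_const _), integral_const_mul, integral_const_mul,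
      integral_complex_ofReal, integral_complex_ofReal, hm, charFun_apply_real]
    simp
    ring
  rw [key]
  have ib : Integrable (fun x : ℝ => 3 * |t| ^ 3 * c * x ^ 2
      + 3 * t ^ 2 * Set.indicator {x : ℝ | c ≤ |x|} (fun x => x ^ 2) x) μ :=
    (i2.const_mul _).add ((i2.indicator hs).const_mul _)
  refine (norm_integral_le_of_norm_le ib (ae_of_all _ fun x => ?_)).trans (le_of_eq ?_)
  · obtain ⟨h1, h2⟩ := norm_exp_mul_I_sub_taylor_le (t * x)
    by_cases hx : c ≤ |x|
    · rw [Set.indicator_of_mem (by exact hx)]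
      have : 0 ≤ 3 * |t| ^ 3 * c * x ^ 2 := by positivity
      nlinarith [h2]
    · rw [Set.indicator_of_notMem (by exact hx)]
      refine h1.trans ?_
      have : |x| ^ 3 ≤ c * x ^ 2 := by
        rw [← sq_abs x]; nlinarith [sq_nonneg |x|, not_le.1 hx]
      have h3 := mul_le_mul_of_nonneg_left this (pow_nonneg (abs_nonneg t) 3)
      rw [abs_mul, mul_pow]
      linarith
  · rw [integral_add (i2.const_mul _) ((i2.indicator hs).const_mul _), integral_const_mul,
      integral_const_mul, integral_indicator hs]

theorem abs_exp_neg_sub_one_sub_le {a : ℝ} (ha : 0 ≤ a) : |Real.exp (-a) - (1 - a)| ≤ a ^ 2 := by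
  have h1 := Real.add_one_le_exp (-a)
  rw [abs_of_nonneg (by linarith)]
  rcases le_total a 1 with h | h
  · have := Real.norm_exp_sub_one_sub_id_le (x := -a) (by simpa [abs_of_nonneg ha] using h)
    rw [norm_neg, Real.norm_eq_abs, Real.norm_eq_abs, sq_abs] at this
    linarith [le_abs_self (Real.exp (-a) - 1 - -a)]
  · have : Real.exp (-a) ≤ 1 := Real.exp_le_one_iff.2 (by linarith)
    nlinarith

theorem norm_prod_sub_prod_le_sum {ι R : Type*} [NormedCommRing R] [NormOneClass R] (s : Finset ι)
    {a b : ι → R} (ha : ∀ i ∈ s, ‖a i‖ ≤ 1) (hb : ∀ i ∈ s, ‖b i‖ ≤ 1) :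
    ‖∏ i ∈ s, a i - ∏ i ∈ s, b i‖ ≤ ∑ i ∈ s, ‖a i - b i‖ := by
  classical
  induction s using Finset.induction_on with
  | empty => simp
  | insert j s hj ih =>
    rw [Finset.prod_insert hj, Finset.prod_insert hj, Finset.sum_insert hj]
    have h1 := ih (fun i hi => ha i (Finset.mem_insert_of_mem hi))
      (fun i hi => hb i (Finset.mem_insert_of_mem hi))
    have h2 : ‖∏ i ∈ s, a i‖ ≤ 1 := (Finset.norm_prod_le _ _).trans
      (Finset.prod_le_one (fun _ _ => norm_nonneg _)
        (fun i hi => ha i (Finset.mem_insert_of_mem hi)))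
    have e : a j * ∏ i ∈ s, a i - b j * ∏ i ∈ s, b i =
        (a j - b j) * ∏ i ∈ s, a i + b j * (∏ i ∈ s, a i - ∏ i ∈ s, b i) := by ring
    rw [e]
    refine (norm_add_le _ _).trans (add_le_add ?_ ?_)
    · exact (norm_mul_le _ _).trans (mul_le_of_le_one_right (norm_nonneg _) h2)
    · exact (norm_mul_le _ _).trans ((mul_le_of_le_one_left (norm_nonneg _)
        (hb j (Finset.mem_insert_self _ _))).trans h1)

/-- Lets the Lindeberg tails control each single variance, so that no separate Feller condition is
required. -/
theorem integral_sq_le_add_setIntegral {μ : Measure ℝ} [IsProbabilityMeasure μ]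
    (hL : MemLp id 2 μ) {c : ℝ} :
    ∫ x, x ^ 2 ∂μ ≤ c ^ 2 + ∫ x in {x : ℝ | c ≤ |x|}, x ^ 2 ∂μ := by
  have i2 : Integrable (fun x : ℝ => x ^ 2) μ := hL.integrable_sq
  have hs : MeasurableSet {x : ℝ | c ≤ |x|} := measurableSet_le measurable_const (by fun_prop)
  calc ∫ x, x ^ 2 ∂μ ≤ ∫ x, c ^ 2 + Set.indicator {x : ℝ | c ≤ |x|} (fun x => x ^ 2) x ∂μ := by
        refine integral_mono i2 ((integrable_const _).add (i2.indicator hs)) fun x => ?_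
        by_cases hx : c ≤ |x|
        · simp only [Set.indicator_of_mem (show x ∈ {x : ℝ | c ≤ |x|} from hx)]
          nlinarith
        · simp only [Set.indicator_of_notMem (show x ∉ {x : ℝ | c ≤ |x|} from hx), add_zero]
          rw [← sq_abs x]; nlinarith [abs_nonneg x, not_le.1 hx]
    _ = _ := by
        rw [integral_add (integrable_const _) (i2.indicator hs), integral_indicator hs]; simp

/-! ### Lindeberg's theorem with explicit error -/

section Lindeberg

variable {Ω : Type*} [MeasurableSpace Ω] {P : Measure Ω} {X : ℕ → Ω → ℝ}

theorem varSum_nonneg (P : Measure Ω) (X : ℕ → Ω → ℝ) (k : ℕ) : 0 ≤ varSum P X k :=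
  Finset.sum_nonneg fun _ _ => variance_nonneg _ _

theorem measurable_partialSum (hX : ∀ i, Measurable (X i)) (k : ℕ) :
    Measurable (partialSum X k) := by
  unfold partialSum; fun_prop

theorem charFun_map_partialSum (hX : ∀ i, Measurable (X i)) (hind : iIndepFun X P) (k : ℕ) (u : ℝ) :
    charFun (P.map (partialSum X k)) u = ∏ i ∈ Finset.range k, charFun (P.map (X i)) u := by
  have := (hind.restrict (Finset.range k)).charFun_map_fun_finsetSum_eq_prod
    (fun i _ => (hX i).aemeasurable)
  have h2 := congrFun this u
  rw [Finset.prod_apply] at h2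
  exact h2

variable [IsProbabilityMeasure P]

/-- Both sides are products of factors of norm at most 1, so the error is at most the sum of the
factor errors. Each factor is compared with 1 - u²v_i/2. -/
theorem norm_charFun_partialSum_sub_exp_le (hX : ∀ i, Measurable (X i)) (hind : iIndepFun X P)
    (hsq : ∀ i, MemLp (X i) 2 P) (hmean : ∀ i, ∫ ω, X i ω ∂P = 0) (k : ℕ) (u : ℝ) {c : ℝ}
    (hc : 0 ≤ c) :
    ‖charFun (P.map (partialSum X k)) u - Complex.exp (-(u ^ 2 * varSum P X k / 2 : ℝ))‖ ≤
      3 * |u| ^ 3 * c * varSum P X k + u ^ 4 / 4 * c ^ 2 * varSum P X k +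
        (3 * u ^ 2 + u ^ 4 / 4 * varSum P X k) *
          ∑ i ∈ Finset.range k, ∫ x in {x : ℝ | c ≤ |x|}, x ^ 2 ∂(P.map (X i)) := by
  have hprob : ∀ i, IsProbabilityMeasure (P.map (X i)) := fun i =>
    Measure.isProbabilityMeasure_map (hX i).aemeasurable
  have hL : ∀ i, MemLp id 2 (P.map (X i)) := fun i =>
    (memLp_map_measure_iff (by fun_prop) (hX i).aemeasurable).2 (hsq i)
  have hv : ∀ i, ∫ x, x ^ 2 ∂(P.map (X i)) = variance (X i) P := fun i => by
    rw [integral_map (hX i).aemeasurable (by fun_prop),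
      variance_of_integral_eq_zero (hX i).aemeasurable (hmean i)]
  have hm : ∀ i, ∫ x, x ∂(P.map (X i)) = 0 := fun i => by
    rw [integral_map (hX i).aemeasurable (by fun_prop), hmean i]
  set v : ℕ → ℝ := fun i => variance (X i) P with hvdef
  set l : ℕ → ℝ := fun i => ∫ x in {x : ℝ | c ≤ |x|}, x ^ 2 ∂(P.map (X i)) with hldef
  have hv0 : ∀ i, 0 ≤ v i := fun i => variance_nonneg _ _
  have hl0 : ∀ i, 0 ≤ l i := fun i => integral_nonneg fun x => sq_nonneg x
  have hV : varSum P X k = ∑ i ∈ Finset.range k, v i := rfl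
  have hexp : Complex.exp (-(u ^ 2 * varSum P X k / 2 : ℝ)) =
      ∏ i ∈ Finset.range k, ((Real.exp (-(u ^ 2 * v i / 2)) : ℝ) : ℂ) := by
    rw [← Complex.ofReal_prod, ← Real.exp_sum, ← Complex.ofReal_neg, ← Complex.ofReal_exp]
    congr 2
    rw [hV, Finset.sum_neg_distrib, Finset.mul_sum, Finset.sum_div]
  rw [charFun_map_partialSum hX hind, hexp]
  refine (norm_prod_sub_prod_le_sum _ (fun i _ => norm_charFun_le_one u) (fun i _ => ?_)).trans ?_
  · rw [Complex.norm_real, Real.norm_eq_abs, Real.abs_exp]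
    exact Real.exp_le_one_iff.2 (by have := hv0 i; have : 0 ≤ u ^ 2 * v i / 2 := by positivity
                                    linarith)
  have hterm : ∀ i ∈ Finset.range k,
      ‖charFun (P.map (X i)) u - ((Real.exp (-(u ^ 2 * v i / 2)) : ℝ) : ℂ)‖ ≤
        (3 * |u| ^ 3 * c + u ^ 4 / 4 * c ^ 2) * v i
          + (3 * u ^ 2 + u ^ 4 / 4 * varSum P X k) * l i := by
    intro i hi
    have h1 := norm_charFun_sub_taylor_le (hL i) (hm i) hc u
    rw [hv i] at h1
    have h2 := abs_exp_neg_sub_one_sub_le (a := u ^ 2 * v i / 2)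
      (by have := hv0 i; positivity)
    have h3 : v i ≤ c ^ 2 + l i := by
      have := integral_sq_le_add_setIntegral (hL i) (c := c)
      rwa [hv i] at this
    have h4 : v i ≤ varSum P X k := by
      rw [hV]; exact Finset.single_le_sum (fun j _ => hv0 j) hi
    -- One factor v_i is replaced by c² + l_i, and in v_i·l_i the other is bounded by the full
    -- variance; the result is linear in v_i and l_i, ready to sum.
    have h5 : v i ^ 2 ≤ c ^ 2 * v i + varSum P X k * l i := by
      nlinarith [mul_le_mul_of_nonneg_left h3 (hv0 i), mul_le_mul_of_nonneg_right h4 (hl0 i)]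
    have h6 := mul_le_mul_of_nonneg_left h5 (show 0 ≤ u ^ 4 / 4 by positivity)
    have e : charFun (P.map (X i)) u - ((Real.exp (-(u ^ 2 * v i / 2)) : ℝ) : ℂ) =
        (charFun (P.map (X i)) u - (1 - u ^ 2 * ((v i : ℝ) : ℂ) / 2)) -
        ((Real.exp (-(u ^ 2 * v i / 2)) - (1 - u ^ 2 * v i / 2) : ℝ) : ℂ) := by
      push_cast; ring
    rw [e]
    refine (norm_sub_le _ _).trans ?_
    rw [Complex.norm_real, Real.norm_eq_abs]
    change ‖charFun (P.map (X i)) u - (1 - u ^ 2 * ((v i : ℝ) : ℂ) / 2)‖ ≤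
      3 * |u| ^ 3 * c * v i + 3 * u ^ 2 * l i at h1
    nlinarith
  refine (Finset.sum_le_sum hterm).trans (le_of_eq ?_)
  rw [Finset.sum_add_distrib, ← Finset.mul_sum, ← Finset.mul_sum, ← hV]
  ring

/-- Lindeberg's central limit theorem, with the uniformity over bounded frequencies. -/
theorem exists_forall_norm_charFun_partialSum_sub_exp_le (hX : ∀ i, Measurable (X i))
    (hind : iIndepFun X P) (hsq : ∀ i, MemLp (X i) 2 P) (hmean : ∀ i, ∫ ω, X i ω ∂P = 0)
    (hvar : ∀ i, 0 < variance (X i) P) (hLin : LindebergCondition P X) {R ε : ℝ}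
    (hε : 0 < ε) :
    ∃ k₀ : ℕ, ∀ k ≥ k₀, ∀ u : ℝ, |u| * √(varSum P X k) ≤ R →
      ‖charFun (P.map (partialSum X k)) u - Complex.exp (-(u ^ 2 * varSum P X k / 2 : ℝ))‖ ≤ ε := by
  -- With c = τB_k the bound depends only on w = |u|B_k ≤ R, τ and the Lindeberg ratio. Fixing τ
  -- first makes the part without the ratio small.
  obtain ⟨τ, hτ, hτ0⟩ : ∃ τ : ℝ, 3 * R ^ 3 * τ + R ^ 4 / 4 * τ ^ 2 < ε / 2 ∧ 0 < τ := by
    have hcont : Tendsto (fun τ : ℝ => 3 * R ^ 3 * τ + R ^ 4 / 4 * τ ^ 2) (𝓝[>] 0) (𝓝 0) := by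
      have : Continuous (fun τ : ℝ => 3 * R ^ 3 * τ + R ^ 4 / 4 * τ ^ 2) := by fun_prop
      simpa using (this.tendsto 0).mono_left nhdsWithin_le_nhds
    exact ((hcont.eventually_lt_const (by linarith : (0 : ℝ) < ε / 2)).and
      self_mem_nhdsWithin).exists
  have hev := ((hLin τ hτ0).const_mul (3 * R ^ 2 + R ^ 4 / 4)).eventually_lt_const
    (show (3 * R ^ 2 + R ^ 4 / 4) * 0 < ε / 2 by linarith)
  obtain ⟨k₁, hk₁⟩ := eventually_atTop.1 hev
  refine ⟨max k₁ 1, fun k hk u hu => ?_⟩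
  have hΛ := hk₁ k (le_of_max_le_left hk)
  have hV : 0 < varSum P X k := Finset.sum_pos (fun i _ => hvar i)
    ⟨0, Finset.mem_range.2 (le_of_max_le_right hk)⟩
  set V := varSum P X k
  set b := √V with hb
  have hb0 : 0 < b := Real.sqrt_pos.2 hV
  have hbV : b ^ 2 = V := Real.sq_sqrt hV.le
  refine (norm_charFun_partialSum_sub_exp_le hX hind hsq hmean k u
    (c := τ * b) (by positivity)).trans ?_
  set T := ∑ i ∈ Finset.range k, ∫ x in {x : ℝ | τ * b ≤ |x|}, x ^ 2 ∂(P.map (X i))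
  have hT : 0 ≤ T := Finset.sum_nonneg fun i _ => integral_nonneg fun x => sq_nonneg x
  have hTV : T = V * (1 / V * T) := by field_simp
  set Λ := 1 / V * T
  have hΛ0 : 0 ≤ Λ := by positivity
  change 3 * |u| ^ 3 * (τ * b) * V + u ^ 4 / 4 * (τ * b) ^ 2 * V
    + (3 * u ^ 2 + u ^ 4 / 4 * V) * T ≤ ε
  set w := |u| * b with hw
  have hw0 : 0 ≤ w := by positivity
  have hu2 : u ^ 2 = |u| ^ 2 := (sq_abs u).symm
  have hu4 : u ^ 4 = |u| ^ 4 := by rw [show u ^ 4 = (u ^ 2) ^ 2 by ring, hu2]; ring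
  have e : 3 * |u| ^ 3 * (τ * b) * V + u ^ 4 / 4 * (τ * b) ^ 2 * V
    + (3 * u ^ 2 + u ^ 4 / 4 * V) * T =
      (3 * w ^ 3 * τ + w ^ 4 / 4 * τ ^ 2) + (3 * w ^ 2 + w ^ 4 / 4) * Λ := by
    rw [hTV, hu4, hu2, ← hbV, hw]; ring
  rw [e]
  have : 3 * w ^ 3 * τ + w ^ 4 / 4 * τ ^ 2 ≤ 3 * R ^ 3 * τ + R ^ 4 / 4 * τ ^ 2 := by gcongr
  have : (3 * w ^ 2 + w ^ 4 / 4) * Λ ≤ (3 * R ^ 2 + R ^ 4 / 4) * Λ := by gcongr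
  linarith

end Lindeberg

/-! ### Laplace transforms on the half-line -/

/-- A finite measure on the nonnegative half-line is determined by the values of its Laplace
transform at the natural numbers. -/
theorem ext_of_integral_exp_neg_nat_mul {μ ν : Measure ℝ} [IsFiniteMeasure μ] [IsFiniteMeasure ν]
    (hμ : ∀ᵐ x ∂μ, 0 ≤ x) (hν : ∀ᵐ x ∂ν, 0 ≤ x)
    (h : ∀ k : ℕ, ∫ x, Real.exp (-(k * x)) ∂μ = ∫ x, Real.exp (-(k * x)) ∂ν) : μ = ν := by
  -- The map x ↦ e^{-x} turns the Laplace transform at k into the k-th moment on [0,1], where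
  -- Weierstrass approximation applies.
  let T : ℝ → unitInterval := fun x =>
    ⟨Real.exp (-max x 0), (Real.exp_pos _).le, Real.exp_le_one_iff.2 (by simp)⟩
  have hT : Measurable T := Measurable.subtype_mk (by fun_prop)
  let S : unitInterval → ℝ := fun y => -Real.log y
  have hS : Measurable S := by fun_prop
  have hTS : ∀ x, 0 ≤ x → S (T x) = x := fun x hx => by simp [S, T, hx]
  have back : ∀ (ρ : Measure ℝ), (∀ᵐ x ∂ρ, 0 ≤ x) → (ρ.map T).map S = ρ := fun ρ hρ => by
    rw [Measure.map_map hS hT]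
    conv_rhs => rw [← Measure.map_id (μ := ρ)]
    refine Measure.map_congr ?_
    filter_upwards [hρ] with x hx using hTS x hx
  rw [← back μ hμ, ← back ν hν]
  congr 1
  have hpow : ∀ (ρ : Measure ℝ), (∀ᵐ x ∂ρ, 0 ≤ x) → ∀ k : ℕ,
      ∫ y : unitInterval, (y : ℝ) ^ k ∂(ρ.map T) = ∫ x, Real.exp (-(k * x)) ∂ρ := fun ρ hρ k => by
    rw [integral_map hT.aemeasurable (by fun_prop)]
    refine integral_congr_ae ?_
    filter_upwards [hρ] with x hx
    simp only [T, max_eq_left hx, ← Real.exp_nat_mul]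
    ring_nf
  have hpoly : ∀ p : Polynomial ℝ, ∫ y : unitInterval, p.eval (y : ℝ) ∂(μ.map T) =
      ∫ y : unitInterval, p.eval (y : ℝ) ∂(ν.map T) := by
    intro p
    have hint : ∀ (ρ : Measure unitInterval) [IsFiniteMeasure ρ] (q : Polynomial ℝ),
        Integrable (fun y : unitInterval => q.eval (y : ℝ)) ρ := fun ρ _ q =>
      (BoundedContinuousFunction.mkOfCompact
        ⟨fun y : unitInterval => q.eval (y : ℝ), by fun_prop⟩).integrable ρ
    induction p using Polynomial.induction_on' with
    | add p q hp hq =>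
      simp only [Polynomial.eval_add]
      rw [integral_add (hint _ _) (hint _ _), integral_add (hint _ _) (hint _ _), hp, hq]
    | monomial n a =>
      simp only [Polynomial.eval_monomial]
      rw [integral_const_mul, integral_const_mul, hpow μ hμ, hpow ν hν, h]
  refine ext_of_forall_integral_eq_of_IsFiniteMeasure fun f => ?_
  refine eq_of_forall_dist_le fun ε hε => ?_
  set C : ℝ := (μ.map T).real Set.univ + (ν.map T).real Set.univ + 1
  have hC : 0 < C := by positivity
  obtain ⟨p, hp⟩ := exists_polynomial_near_continuousMap 0 1 f.toContinuousMap (ε / C)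
    (by positivity)
  have hnear : ∀ (ρ : Measure unitInterval) [IsFiniteMeasure ρ],
      |∫ y, f y ∂ρ - ∫ y : unitInterval, p.eval (y : ℝ) ∂ρ| ≤ ε / C * ρ.real Set.univ := by
    intro ρ _
    have ip : Integrable (fun y : unitInterval => p.eval (y : ℝ)) ρ :=
      (BoundedContinuousFunction.mkOfCompact
        ⟨fun y : unitInterval => p.eval (y : ℝ), by fun_prop⟩).integrable ρ
    rw [← integral_sub (f.integrable ρ) ip, ← Real.norm_eq_abs]
    refine norm_integral_le_of_norm_le_const (ae_of_all ρ fun y => ?_)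
    have := ContinuousMap.norm_coe_le_norm (p.toContinuousMapOn _ - f.toContinuousMap) y
    rw [norm_sub_rev]
    exact this.trans hp.le
  have h1 := hnear (μ.map T)
  have h2 := hnear (ν.map T)
  rw [hpoly p] at h1
  rw [Real.dist_eq]
  have h3 : ε / C * (μ.map T).real Set.univ + ε / C * (ν.map T).real Set.univ ≤ ε := by
    rw [← mul_add, div_mul_eq_mul_div, div_le_iff₀ hC]
    nlinarith
  rw [abs_le] at *
  constructor <;> linarith

/-- Lévy's continuity theorem for Laplace transforms, for tight sequences. -/
theorem exists_tendsto_of_tendsto_integral_exp {ν : ℕ → ProbabilityMeasure ℝ} {F : ℝ → ℝ}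
    (htight : IsTightMeasureSet {(ν n : Measure ℝ) | n})
    (hpos : ∀ n, ∀ᵐ x ∂(ν n : Measure ℝ), 0 ≤ x)
    (hF : ∀ s, 0 ≤ s →
      Tendsto (fun n => ∫ x, Real.exp (-(s * x)) ∂(ν n : Measure ℝ)) atTop (𝓝 (F s))) :
    ∃ μ : ProbabilityMeasure ℝ, (∀ᵐ x ∂(μ : Measure ℝ), 0 ≤ x) ∧
      (∀ s, 0 ≤ s → ∫ x, Real.exp (-(s * x)) ∂(μ : Measure ℝ) = F s) ∧
      Tendsto ν atTop (𝓝 μ) := by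
  have hcompact : IsCompact (closure {ν n | n}) :=
    isCompact_closure_of_isTightMeasureSet (by simpa using htight)
  -- Tightness gives a limit along every ultrafilter; all these limits share the transform `F`,
  -- hence coincide, and the sequence converges.
  have hlim : ∀ U : Ultrafilter ℕ, (U : Filter ℕ) ≤ atTop → ∃ μ : ProbabilityMeasure ℝ,
      Tendsto ν U (𝓝 μ) := fun U _ => by
    obtain ⟨μ, -, hμ⟩ := hcompact.ultrafilter_le_nhds (U.map ν)
      (.trans (by simp) (monotone_principal subset_closure))
    exact ⟨μ, hμ⟩
  have hprop : ∀ (U : Ultrafilter ℕ) (μ : ProbabilityMeasure ℝ), (U : Filter ℕ) ≤ atTop →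
      Tendsto ν U (𝓝 μ) → (∀ᵐ x ∂(μ : Measure ℝ), 0 ≤ x) ∧
        ∀ s, 0 ≤ s → ∫ x, Real.exp (-(s * x)) ∂(μ : Measure ℝ) = F s := by
    intro U μ hU hμ
    have hpos' : ∀ᵐ x ∂(μ : Measure ℝ), 0 ≤ x := by
      have := ProbabilityMeasure.le_liminf_measure_open_of_tendsto hμ (isOpen_Iio (a := (0 : ℝ)))
      have h0 : ∀ n, (ν n : Measure ℝ) (Set.Iio 0) = 0 := fun n => by
        simpa [ae_iff, Set.Iio] using hpos n
      simp only [h0, liminf_const, nonpos_iff_eq_zero] at this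
      simpa [ae_iff, Set.Iio] using this
    refine ⟨hpos', fun s hs => ?_⟩
    -- Truncating at 0 makes the exponential bounded on all of ℝ without changing integrals over
    -- nonnegative laws.
    let g : BoundedContinuousFunction ℝ ℝ := BoundedContinuousFunction.ofNormedAddCommGroup
      (fun x => Real.exp (-(s * max x 0))) (by fun_prop) 1 (fun x => by
        rw [Real.norm_eq_abs, Real.abs_exp]
        exact Real.exp_le_one_iff.2 (by have := le_max_right x 0; nlinarith [mul_nonneg hs this]))
    have hg : ∀ ρ : Measure ℝ, (∀ᵐ x ∂ρ, 0 ≤ x) →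
        ∫ x, g x ∂ρ = ∫ x, Real.exp (-(s * x)) ∂ρ := fun ρ hρ => by
      refine integral_congr_ae ?_
      filter_upwards [hρ] with x hx
      simp [g, max_eq_left hx]
    have h1 := ProbabilityMeasure.tendsto_iff_forall_integral_tendsto.1 hμ g
    simp_rw [hg _ hpos', hg _ (hpos _)] at h1
    exact tendsto_nhds_unique h1 ((hF s hs).mono_left hU)
  obtain ⟨μ, hμ⟩ := hlim (hyperfilter ℕ) Nat.hyperfilter_le_atTop
  obtain ⟨h1, h2⟩ := hprop _ μ Nat.hyperfilter_le_atTop hμ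
  refine ⟨μ, h1, h2, (tendsto_iff_ultrafilter _ _ _).2 fun U hU => ?_⟩
  obtain ⟨μ', hμ'⟩ := hlim U hU
  obtain ⟨h1', h2'⟩ := hprop _ μ' hU hμ'
  have : μ' = μ := Subtype.ext (ext_of_integral_exp_neg_nat_mul (μ := (μ' : Measure ℝ)) (ν := (μ : Measure ℝ)) h1' h1 fun k => by
    exact (h2' k k.cast_nonneg).trans (h2 k k.cast_nonneg).symm)
  exact this ▸ hμ'

/-! ### Tightness -/

section Tightness

variable {Ω : Type*} [MeasurableSpace Ω] {P : Measure Ω} [IsProbabilityMeasure P]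

theorem MeasureTheory.TendstoInDistribution.exists_measureReal_lt_abs_le {Ω' : Type*} [MeasurableSpace Ω']
    {Q : Measure Ω'} [IsProbabilityMeasure Q] {Z : ℕ → Ω → ℝ} {W : Ω' → ℝ}
    (h : TendstoInDistribution Z atTop W (fun _ => P) Q) {ε : ℝ} (hε : 0 < ε) :
    ∃ R : ℝ, 0 < R ∧ ∀ n, P.real {ω | R < |Z n ω|} ≤ ε := by
  have hprob : ∀ n, IsProbabilityMeasure (P.map (Z n)) := fun n =>
    Measure.isProbabilityMeasure_map (h.forall_aemeasurable n)
  have hlim := Measure.isProbabilityMeasure_map h.aemeasurable_limit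
  have htight : IsTightMeasureSet (Set.range fun n => P.map (Z n)) :=
    isTightMeasureSet_of_tendsto_charFun (f := charFun (Q.map W)) (by fun_prop)
      (ProbabilityMeasure.tendsto_iff_tendsto_charFun.1 h.tendsto)
  have hev := (tendsto_measure_norm_gt_of_isTightMeasureSet htight).eventually_le_const
    (show (0 : ENNReal) < ENNReal.ofReal ε by simpa using hε)
  obtain ⟨R, hR, hR0⟩ := (hev.and (eventually_gt_atTop 0)).exists
  refine ⟨R, hR0, fun n => ?_⟩
  have h1 : P.map (Z n) {x | R < ‖x‖} ≤ ENNReal.ofReal ε :=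
    (le_iSup₂ (f := fun (μ : Measure ℝ) (_ : μ ∈ Set.range fun n => P.map (Z n)) =>
      μ {x | R < ‖x‖}) _ ⟨n, rfl⟩).trans hR
  rw [Measure.map_apply_of_aemeasurable (h.forall_aemeasurable n)
    (measurableSet_lt measurable_const (by fun_prop))] at h1
  exact ENNReal.toReal_le_of_le_ofReal hε.le h1

theorem isTightMeasureSet_map_of_eventually_measureReal_le {Z : ℕ → Ω → ℝ}
    (hZ : ∀ n, AEMeasurable (Z n) P)
    (h : ∀ ε : ℝ, 0 < ε → ∃ R : ℝ, ∀ᶠ n in atTop, P.real {ω | R < |Z n ω|} ≤ ε) :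
    IsTightMeasureSet (Set.range fun n => P.map (Z n)) := by
  have hprob : ∀ n, IsProbabilityMeasure (P.map (Z n)) := fun n =>
    Measure.isProbabilityMeasure_map (hZ n)
  refine isTightMeasureSet_range_of_tendsto_limsup_measure_norm_gt ?_
  refine ENNReal.tendsto_nhds_zero.2 fun ε hε => ?_
  rcases eq_or_ne ε ⊤ with rfl | hε'
  · simp
  obtain ⟨R, hR⟩ := h ε.toReal (ENNReal.toReal_pos hε.ne' hε')
  filter_upwards [eventually_ge_atTop R] with r hr
  refine limsup_le_of_le (by isBoundedDefault) ?_
  filter_upwards [hR] with n hn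
  rw [Measure.map_apply_of_aemeasurable (hZ n)
    (measurableSet_lt measurable_const (by fun_prop))]
  refine (measure_mono fun ω (hω : r < ‖Z n ω‖) => lt_of_le_of_lt hr hω).trans ?_
  exact (ENNReal.toReal_le_toReal (measure_ne_top _ _) hε').1 hn

end Tightness

/-! ### Conditioning on the random index -/

section RandomSum

variable {Ω : Type*} [MeasurableSpace Ω] {P : Measure Ω} [IsProbabilityMeasure P] {X : ℕ → Ω → ℝ}

theorem measurable_partialSum_comp (hX : ∀ i, Measurable (X i)) {N : Ω → ℕ} (hN : Measurable N) :
    Measurable (fun ω => partialSum X (N ω) ω) :=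
  (measurable_from_prod_countable_right (f := fun p : ℕ × Ω => partialSum X p.1 p.2)
    fun k => measurable_partialSum hX k).comp (hN.prodMk measurable_id)

/-- Conditioning on an independent summation index. -/
theorem integral_comp_partialSum {E : Type*} [NormedAddCommGroup E] [NormedSpace ℝ E]
    [MeasurableSpace E] [BorelSpace E] [SecondCountableTopology E]
    (hX : ∀ i, Measurable (X i)) {N : Ω → ℕ} (hN : Measurable N)
    (hind : IndepFun N (fun ω i => X i ω) P) {f : ℕ → ℝ → E}
    (hf : ∀ k, Measurable (f k)) {C : ℝ} (hC : ∀ k x, ‖f k x‖ ≤ C) :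
    ∫ ω, f (N ω) (partialSum X (N ω) ω) ∂P =
      ∫ ω, (∫ ω', f (N ω) (partialSum X (N ω) ω') ∂P) ∂P := by
  have hXm : Measurable (fun ω i => X i ω) := measurable_pi_iff.2 hX
  let s : ℕ → (ℕ → ℝ) → ℝ := fun k x => ∑ i ∈ Finset.range k, x i
  have hs : ∀ k, Measurable (s k) := fun k => by fun_prop
  let G : ℕ × (ℕ → ℝ) → E := fun p => f p.1 (s p.1 p.2)
  have hG : StronglyMeasurable G := (measurable_from_prod_countable_right (f := G)
    fun k => (hf k).comp (hs k)).stronglyMeasurable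
  have hN' := Measure.isProbabilityMeasure_map (μ := P) hN.aemeasurable
  have hX' := Measure.isProbabilityMeasure_map (μ := P) hXm.aemeasurable
  have hmap := (indepFun_iff_map_prod_eq_prod_map_map hN.aemeasurable hXm.aemeasurable).1 hind
  calc ∫ ω, f (N ω) (partialSum X (N ω) ω) ∂P
      = ∫ p, G p ∂(P.map fun ω => (N ω, fun i => X i ω)) := by
        rw [integral_map (by fun_prop) hG.aestronglyMeasurable]; rfl
    _ = ∫ k, ∫ x, G (k, x) ∂(P.map fun ω i => X i ω) ∂(P.map N) := by
        rw [hmap, integral_prod]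
        exact Integrable.of_bound hG.aestronglyMeasurable C (ae_of_all _ fun p => hC _ _)
    _ = _ := by
        rw [integral_map hN.aemeasurable (StronglyMeasurable.of_discrete.aestronglyMeasurable)]
        refine integral_congr_ae (ae_of_all _ fun ω => ?_)
        exact integral_map hXm.aemeasurable
          (((hf _).comp (hs _)).aestronglyMeasurable)

end RandomSum

/-! ### Transfer between random sums and random variances -/

section RandomSumLimit

variable {Ω : Type*} [MeasurableSpace Ω] {P : Measure Ω} {X : ℕ → Ω → ℝ}

theorem TendstoInProbabilityAtTop.eventually_measureReal_lt_le {N : ℕ → Ω → ℕ}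
    (h : TendstoInProbabilityAtTop P N) (k : ℕ) {ε : ℝ} (hε : 0 < ε) :
    ∀ᶠ n in atTop, P.real {ω | N n ω < k} ≤ ε := by
  -- The level `k + 1` is positive even when `k = 0`.
  have := (h (k + 1) (by positivity)).eventually_le_const
    (show (0 : ENNReal) < ENNReal.ofReal ε by simpa using hε)
  filter_upwards [this] with n hn
  refine ENNReal.toReal_le_of_le_ofReal hε.le ((measure_mono fun ω (hω : N n ω < k) => ?_).trans hn)
  have : (N n ω : ℝ) < k := by exact_mod_cast hω
  exact (by linarith : (N n ω : ℝ) ≤ k + 1)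

variable [IsProbabilityMeasure P]

/-- S*_k/B_k tends to N(0,1), which charges the open set |x| > 1; the portmanteau theorem gives the
lower bound. -/
theorem exists_pos_le_measureReal_sqrt_varSum_lt (hX : ∀ i, Measurable (X i))
    (hind : iIndepFun X P) (hsq : ∀ i, MemLp (X i) 2 P) (hmean : ∀ i, ∫ ω, X i ω ∂P = 0)
    (hvar : ∀ i, 0 < variance (X i) P) (hLin : LindebergCondition P X) :
    ∃ c : ℝ, 0 < c ∧ ∃ k₀ : ℕ, ∀ k ≥ k₀,
      c ≤ P.real {ω | √(varSum P X k) < |partialSum X k ω|} := by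
  have hm : ∀ k, Measurable (fun ω => (√(varSum P X k))⁻¹ * partialSum X k ω) := fun k =>
    (measurable_partialSum hX k).const_mul _
  let μ : ℕ → ProbabilityMeasure ℝ := fun k =>
    ⟨P.map (fun ω => (√(varSum P X k))⁻¹ * partialSum X k ω),
      Measure.isProbabilityMeasure_map (hm k).aemeasurable⟩
  have hconv : Tendsto μ atTop (𝓝 ⟨gaussianReal 0 1, inferInstance⟩) := by
    refine ProbabilityMeasure.tendsto_iff_tendsto_charFun.2 fun t => ?_
    refine Metric.tendsto_atTop'.2 fun ε hε => ?_
    obtain ⟨k₀, hk₀⟩ := exists_forall_norm_charFun_partialSum_sub_exp_le hX hind hsq hmean hvar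
      hLin (R := |t|) (half_pos hε)
    refine ⟨k₀, fun k hk => ?_⟩
    have hV : 0 < varSum P X k := Finset.sum_pos (fun i _ => hvar i)
      ⟨0, Finset.mem_range.2 (lt_of_le_of_lt k₀.zero_le hk)⟩
    have hb := Real.sqrt_pos.2 hV
    have h1 := hk₀ k hk.le ((√(varSum P X k))⁻¹ * t) (by
      rw [abs_mul, abs_of_pos (inv_pos.2 hb)]
      exact le_of_eq (by field_simp))
    have h2 : ((√(varSum P X k))⁻¹ * t) ^ 2 * varSum P X k / 2 = t ^ 2 / 2 := by
      rw [mul_pow, inv_pow, Real.sq_sqrt hV.le]; field_simp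
    rw [h2] at h1
    have h3 : charFun (μ k : Measure ℝ) t =
        charFun (P.map (partialSum X k)) ((√(varSum P X k))⁻¹ * t) :=
      charFun_map_mul_comp (measurable_partialSum hX k).aemeasurable _ _
    have h4 : charFun (gaussianReal 0 1) t = Complex.exp (-(t ^ 2 / 2 : ℝ)) := by
      rw [charFun_gaussianReal]; push_cast; congr 1; simp
    rw [dist_eq_norm, h3]
    refine lt_of_le_of_lt ?_ (half_lt_self hε)
    simpa only [ProbabilityMeasure.coe_mk, h4] using h1
  have hopen : IsOpen {x : ℝ | 1 < |x|} := isOpen_lt continuous_const continuous_abs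
  have hlow := ProbabilityMeasure.le_liminf_measure_open_of_tendsto hconv hopen
  have hg : 0 < gaussianReal 0 1 {x : ℝ | 1 < |x|} := by
    rw [pos_iff_ne_zero]
    intro h0
    have := gaussianReal_absolutelyContinuous' 0 (v := 1) one_ne_zero h0
    exact (hopen.measure_pos volume ⟨2, by simp⟩).ne' this
  obtain ⟨c, hc0, hc⟩ := ENNReal.lt_iff_exists_real_btwn.1 (hg.trans_le hlow)
  obtain ⟨hc1, hc2⟩ := hc
  have hev := eventually_lt_of_lt_liminf hc2
  obtain ⟨k₁, hk₁⟩ := eventually_atTop.1 hev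
  refine ⟨c, by simpa using hc1, max k₁ 1, fun k hk => ?_⟩
  have hV : 0 < varSum P X k := Finset.sum_pos (fun i _ => hvar i)
    ⟨0, Finset.mem_range.2 (le_of_max_le_right hk)⟩
  have hb := Real.sqrt_pos.2 hV
  have h5 : ENNReal.ofReal c < P.map (fun ω => (√(varSum P X k))⁻¹ * partialSum X k ω)
      {x : ℝ | 1 < |x|} := hk₁ k (le_of_max_le_left hk)
  rw [Measure.map_apply (hm k) hopen.measurableSet] at h5
  refine (ENNReal.ofReal_le_iff_le_toReal (measure_ne_top _ _)).1 (h5.le.trans (measure_mono ?_))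
  intro ω hω
  have hω' : 1 < |(√(varSum P X k))⁻¹ * partialSum X k ω| := hω
  rwa [abs_mul, abs_of_pos (inv_pos.2 hb), inv_mul_eq_div, one_lt_div hb] at hω'

/-- If the random sums are stochastically bounded relative to `d`, then so are the random
variances relative to `d ^ 2`. -/
theorem exists_eventually_measureReal_lt_varSum_le (hX : ∀ i, Measurable (X i))
    (hind : iIndepFun X P) (hsq : ∀ i, MemLp (X i) 2 P) (hmean : ∀ i, ∫ ω, X i ω ∂P = 0)
    (hvar : ∀ i, 0 < variance (X i) P) (hLin : LindebergCondition P X)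
    {N : ℕ → Ω → ℕ} (hN : ∀ n, Measurable (N n))
    (hNind : ∀ n, IndepFun (N n) (fun ω i => X i ω) P) (hNtop : TendstoInProbabilityAtTop P N)
    {d : ℕ → ℝ} (hd : ∀ n, 0 < d n)
    (h : ∀ ε : ℝ, 0 < ε →
      ∃ R : ℝ, 0 < R ∧ ∀ n, P.real {ω | R < |partialSum X (N n ω) ω / d n|} ≤ ε)
    {ε : ℝ} (hε : 0 < ε) :
    ∃ R : ℝ, ∀ᶠ n in atTop, P.real {ω | R < |varSum P X (N n ω) / d n ^ 2|} ≤ ε := by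
  obtain ⟨c, hc, k₀, hk₀⟩ :=
    exists_pos_le_measureReal_sqrt_varSum_lt hX hind hsq hmean hvar hLin
  -- Dividing by `c` later leaves ε/2; the other half pays for `N n < k₀`.
  obtain ⟨R, hR, hRn⟩ := h (c * (ε / 2)) (by positivity)
  refine ⟨R ^ 2, ?_⟩
  filter_upwards [hNtop.eventually_measureReal_lt_le k₀ (half_pos hε)] with n hn
  -- For an index in `K`, |S*_k| > B_k implies |S*_k| > R·d_n. Conditioning on the index therefore
  -- gives c·P(N_n ∈ K) ≤ P(|S*_{N_n}| > R·d_n).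
  let K : Set ℕ := {k | k₀ ≤ k ∧ R ^ 2 < |varSum P X k / d n ^ 2|}
  let f : ℕ → ℝ → ℝ := fun k x =>
    K.indicator 1 k * Set.indicator {x : ℝ | √(varSum P X k) < |x|} 1 x
  have hset : ∀ k, MeasurableSet {x : ℝ | √(varSum P X k) < |x|} := fun k =>
    measurableSet_lt measurable_const (by fun_prop)
  have hf : ∀ k, Measurable (f k) := fun k =>
    (measurable_one.indicator (hset k)).const_mul _
  have hind01 : ∀ {β : Type} (s : Set β) (b : β),
      0 ≤ s.indicator (1 : β → ℝ) b ∧ s.indicator (1 : β → ℝ) b ≤ 1 := fun s b => by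
    by_cases hb : b ∈ s <;> simp [hb]
  have hf0 : ∀ k x, 0 ≤ f k x := fun k x => mul_nonneg (hind01 _ _).1 (hind01 _ _).1
  have hf1 : ∀ k x, f k x ≤ 1 := fun k x =>
    mul_le_one₀ (hind01 _ _).2 (hind01 _ _).1 (hind01 _ _).2
  have hcond := integral_comp_partialSum hX (hN n) (hNind n) hf (C := 1) fun k x => by
    rw [Real.norm_eq_abs, abs_of_nonneg (hf0 k x)]; exact hf1 k x
  have hg : ∀ k, ∫ ω, f k (partialSum X k ω) ∂P =
      K.indicator 1 k * P.real {ω | √(varSum P X k) < |partialSum X k ω|} := fun k => by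
    rw [integral_const_mul]
    congr 1
    exact integral_indicator_one ((measurable_partialSum hX k) (hset k))
  simp_rw [hg] at hcond
  have hKm : MeasurableSet {ω | N n ω ∈ K} := hN n (MeasurableSet.of_discrete)
  have hlow : c * P.real {ω | N n ω ∈ K} ≤ ∫ ω, K.indicator 1 (N n ω) *
      P.real {ω' | √(varSum P X (N n ω)) < |partialSum X (N n ω) ω'|} ∂P := by
    rw [← integral_indicator_one hKm, ← integral_const_mul]
    refine integral_mono (((integrable_const 1).indicator hKm).const_mul c) ?_ fun ω => ?_
    · refine Integrable.of_bound (((StronglyMeasurable.of_discrete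
        (f := fun k => K.indicator (1 : ℕ → ℝ) k *
          P.real {ω' | √(varSum P X k) < |partialSum X k ω'|})).comp_measurable
          (hN n)).aestronglyMeasurable) 1 (ae_of_all _ fun ω => ?_)
      rw [Real.norm_eq_abs, abs_of_nonneg (mul_nonneg (hind01 _ _).1 measureReal_nonneg)]
      exact mul_le_one₀ (hind01 _ _).2 measureReal_nonneg measureReal_le_one
    · by_cases hω : N n ω ∈ K
      · have : ω ∈ {ω | N n ω ∈ K} := hω
        simp only [Set.indicator_of_mem hω, Set.indicator_of_mem this, Pi.one_apply, mul_one,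
          one_mul]
        exact hk₀ _ hω.1
      · have : ω ∉ {ω | N n ω ∈ K} := hω
        simp [Set.indicator_of_notMem hω, Set.indicator_of_notMem this]
  have hSm : Measurable fun ω => partialSum X (N n ω) ω := measurable_partialSum_comp hX (hN n)
  have hRm : MeasurableSet {ω | R < |partialSum X (N n ω) ω / d n|} :=
    measurableSet_lt measurable_const (by fun_prop)
  have hup : ∫ ω, f (N n ω) (partialSum X (N n ω) ω) ∂P ≤
      P.real {ω | R < |partialSum X (N n ω) ω / d n|} := by
    rw [← integral_indicator_one hRm]
    refine integral_mono_of_nonneg (ae_of_all _ fun ω => hf0 _ _)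
      ((integrable_const 1).indicator hRm) (ae_of_all _ fun ω => ?_)
    by_cases hω : N n ω ∈ K
    · by_cases hω2 : √(varSum P X (N n ω)) < |partialSum X (N n ω) ω|
      · have hmem : ω ∈ {ω | R < |partialSum X (N n ω) ω / d n|} := by
          have h1 := hω.2
          rw [abs_of_nonneg (div_nonneg (varSum_nonneg P X _) (sq_nonneg _)),
            lt_div_iff₀ (pow_pos (hd n) 2), ← mul_pow] at h1
          have h2 := Real.lt_sqrt_of_sq_lt h1
          change R < |_ / _|
          rw [abs_div, abs_of_pos (hd n), lt_div_iff₀ (hd n)]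
          exact h2.trans hω2
        simp only [Set.indicator_of_mem hmem]
        exact hf1 _ _
      · have : f (N n ω) (partialSum X (N n ω) ω) = 0 := by simp [f, hω2]
        simp only [this]
        exact (hind01 _ _).1
    · have : f (N n ω) (partialSum X (N n ω) ω) = 0 := by simp [f, hω]
      simp only [this]
      exact (hind01 _ _).1
  have hK : P.real {ω | N n ω ∈ K} ≤ ε / 2 :=
    le_of_mul_le_mul_left ((hlow.trans (hcond.symm.le.trans hup)).trans (hRn n)) hc
  have hsub : {ω | R ^ 2 < |varSum P X (N n ω) / d n ^ 2|} ⊆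
      {ω | N n ω < k₀} ∪ {ω | N n ω ∈ K} := fun ω hω => by
    rcases lt_or_ge (N n ω) k₀ with h1 | h1
    · exact Or.inl h1
    · exact Or.inr ⟨h1, hω⟩
  linarith [(measureReal_mono (μ := P) hsub).trans (measureReal_union_le _ _)]

/-- If the random variances are stochastically bounded relative to `d ^ 2`, the characteristic
function of the normalized random sum is asymptotically that of a normal scale mixture. -/
theorem tendsto_charFun_randomSum_sub_integral_exp (hX : ∀ i, Measurable (X i))
    (hind : iIndepFun X P) (hsq : ∀ i, MemLp (X i) 2 P) (hmean : ∀ i, ∫ ω, X i ω ∂P = 0)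
    (hvar : ∀ i, 0 < variance (X i) P) (hLin : LindebergCondition P X)
    {N : ℕ → Ω → ℕ} (hN : ∀ n, Measurable (N n))
    (hNind : ∀ n, IndepFun (N n) (fun ω i => X i ω) P) (hNtop : TendstoInProbabilityAtTop P N)
    {d : ℕ → ℝ} (hd : ∀ n, 0 < d n)
    (h : ∀ ε : ℝ, 0 < ε →
      ∃ R : ℝ, ∀ᶠ n in atTop, P.real {ω | R < |varSum P X (N n ω) / d n ^ 2|} ≤ ε) (t : ℝ) :
    Tendsto (fun n => charFun (P.map fun ω => partialSum X (N n ω) ω / d n) t -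
      ((∫ ω, Real.exp (-(t ^ 2 / 2 * (varSum P X (N n ω) / d n ^ 2))) ∂P : ℝ) : ℂ))
      atTop (𝓝 0) := by
  refine Metric.tendsto_nhds.2 fun ε hε => ?_
  obtain ⟨R, hR⟩ := h (ε / 8) (by positivity)
  -- At u = t/d_n, the bound B_k²/d_n² ≤ R yields |u|·B_k ≤ |t|√R. Good indices cost ε/4, bad ones
  -- 2(ε/8 + ε/8), in total 3ε/4.
  obtain ⟨k₀, hk₀⟩ := exists_forall_norm_charFun_partialSum_sub_exp_le hX hind hsq hmean hvar
      hLin (R := |t| * √R) (show 0 < ε / 4 by positivity)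
  filter_upwards [hR, hNtop.eventually_measureReal_lt_le k₀ (show 0 < ε / 8 by positivity)]
    with n hn1 hn2
  have hSm : Measurable fun ω => partialSum X (N n ω) ω := measurable_partialSum_comp hX (hN n)
  let φ : ℕ → ℂ := fun k => charFun (P.map (partialSum X k)) (t / d n)
  let ψ : ℕ → ℝ := fun k => Real.exp (-(t ^ 2 / 2 * (varSum P X k / d n ^ 2)))
  have hprob : ∀ k, IsProbabilityMeasure (P.map (partialSum X k)) := fun k =>
    Measure.isProbabilityMeasure_map (measurable_partialSum hX k).aemeasurable
  have hφ : ∀ k, ‖φ k‖ ≤ 1 := fun k => norm_charFun_le_one _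
  have hψ : ∀ k, ‖(ψ k : ℂ)‖ ≤ 1 := fun k => by
    rw [Complex.norm_real, Real.norm_eq_abs, Real.abs_exp]
    refine Real.exp_le_one_iff.2 (neg_nonpos.2 ?_)
    have := varSum_nonneg P X k
    positivity
  have e1 : charFun (P.map fun ω => partialSum X (N n ω) ω / d n) t = ∫ ω, φ (N n ω) ∂P := by
    have hc := integral_comp_partialSum hX (hN n) (hNind n)
      (f := fun _ x => Complex.exp (((t / d n : ℝ) : ℂ) * x * Complex.I)) (fun _ => by fun_prop)
      (C := 1) (fun k x => by rw [← Complex.ofReal_mul, Complex.norm_exp_ofReal_mul_I])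
    rw [charFun_apply_real, integral_map (hSm.div_const _).aemeasurable (by fun_prop)]
    convert! hc using 3 with ω ω
    · push_cast; ring_nf
    · simp only [φ]
      rw [charFun_apply_real, integral_map (measurable_partialSum hX _).aemeasurable
        (by fun_prop)]
  have iφ : Integrable (fun ω => φ (N n ω)) P := Integrable.of_bound
    ((StronglyMeasurable.of_discrete (f := φ)).comp_measurable (hN n)).aestronglyMeasurable 1
    (ae_of_all _ fun ω => hφ _)
  have iψ : Integrable (fun ω => (ψ (N n ω) : ℂ)) P := Integrable.of_bound
    ((StronglyMeasurable.of_discrete (f := fun k => (ψ k : ℂ))).comp_measurable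
      (hN n)).aestronglyMeasurable 1 (ae_of_all _ fun ω => hψ _)
  rw [e1, ← integral_complex_ofReal, ← integral_sub iφ iψ, dist_zero_right]
  let B : Set ℕ := {k | R < |varSum P X k / d n ^ 2|} ∪ {k | k < k₀}
  have hBm : MeasurableSet {ω | N n ω ∈ B} := hN n (MeasurableSet.of_discrete)
  have hbound : ∀ ω, ‖φ (N n ω) - (ψ (N n ω) : ℂ)‖ ≤
      ε / 4 + 2 * Set.indicator {ω | N n ω ∈ B} (1 : Ω → ℝ) ω := by
    intro ω
    by_cases hω : N n ω ∈ B
    · have : ω ∈ {ω | N n ω ∈ B} := hω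
      rw [Set.indicator_of_mem this]
      refine (norm_sub_le _ _).trans ?_
      simp only [Pi.one_apply]
      linarith [hφ (N n ω), hψ (N n ω)]
    · have : ω ∉ {ω | N n ω ∈ B} := hω
      rw [Set.indicator_of_notMem this, mul_zero, add_zero]
      obtain ⟨hω1, hω2⟩ := not_or.1 hω
      have hω1 : |varSum P X (N n ω) / d n ^ 2| ≤ R := not_lt.1 hω1
      have hω2 : k₀ ≤ N n ω := not_lt.1 hω2
      have h1 := hk₀ _ hω2 (t / d n) (by
        rw [abs_div, abs_of_pos (hd n), div_mul_eq_mul_div, mul_div_assoc]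
        refine mul_le_mul_of_nonneg_left ?_ (abs_nonneg t)
        rw [show √(varSum P X (N n ω)) / d n = √(varSum P X (N n ω) / d n ^ 2) by
          rw [Real.sqrt_div' _ (sq_nonneg _), Real.sqrt_sq (hd n).le]]
        exact Real.sqrt_le_sqrt ((le_abs_self _).trans hω1))
      convert! h1 using 3
      simp only [ψ]
      push_cast
      congr 1
      ring
  have hint : Integrable (fun ω => ε / 4 + 2 * Set.indicator {ω | N n ω ∈ B} (1 : Ω → ℝ) ω) P :=
    (integrable_const _).add (((integrable_const 1).indicator hBm).const_mul 2)
  refine lt_of_le_of_lt (norm_integral_le_of_norm_le hint (ae_of_all _ hbound)) ?_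
  rw [integral_add (integrable_const _) (((integrable_const 1).indicator hBm).const_mul 2),
    integral_const_mul, integral_indicator_one hBm]
  have hB : P.real {ω | N n ω ∈ B} ≤ ε / 8 + ε / 8 :=
    (measureReal_union_le {ω | R < |varSum P X (N n ω) / d n ^ 2|} {ω | N n ω < k₀}).trans
      (add_le_add hn1 hn2)
  simp
  linarith

end RandomSumLimit

/-! ### Laplace limits and normal scale mixtures -/

/-- Convergence in distribution of nonnegative random variables implies convergence of the Laplace
transforms. -/
theorem MeasureTheory.TendstoInDistribution.tendsto_integral_exp_neg_mul {Ω Ω' : Type*} [MeasurableSpace Ω]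
    [MeasurableSpace Ω'] {P : Measure Ω} [IsProbabilityMeasure P] {Q : Measure Ω'}
    [IsProbabilityMeasure Q] {Z : ℕ → Ω → ℝ} {W : Ω' → ℝ}
    (h : TendstoInDistribution Z atTop W (fun _ => P) Q) (hZ : ∀ n, ∀ᵐ ω ∂P, 0 ≤ Z n ω)
    (hW : ∀ᵐ ω ∂Q, 0 ≤ W ω) {s : ℝ} (hs : 0 ≤ s) :
    Tendsto (fun n => ∫ ω, Real.exp (-(s * Z n ω)) ∂P) atTop
      (𝓝 (∫ ω, Real.exp (-(s * W ω)) ∂Q)) := by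
  let g : BoundedContinuousFunction ℝ ℝ := BoundedContinuousFunction.ofNormedAddCommGroup
    (fun x => Real.exp (-(s * max x 0))) (by fun_prop) 1 (fun x => by
      rw [Real.norm_eq_abs, Real.abs_exp]
      exact Real.exp_le_one_iff.2 (by nlinarith [mul_nonneg hs (le_max_right x 0)]))
  have hg : ∀ n, ∫ x, g x ∂(P.map (Z n)) = ∫ ω, Real.exp (-(s * Z n ω)) ∂P := fun n => by
    rw [integral_map (h.forall_aemeasurable n) g.continuous.aestronglyMeasurable]
    refine integral_congr_ae ?_
    filter_upwards [hZ n] with x hx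
    simp [g, max_eq_left hx]
  have h1 := ProbabilityMeasure.tendsto_iff_forall_integral_tendsto.1 h.tendsto g
  have hW' : ∫ x, g x ∂(Q.map W) = ∫ ω, Real.exp (-(s * W ω)) ∂Q := by
    rw [integral_map h.aemeasurable_limit g.continuous.aestronglyMeasurable]
    refine integral_congr_ae ?_
    filter_upwards [hW] with x hx
    simp [g, max_eq_left hx]
  simp only [ProbabilityMeasure.coe_mk, hW', hg] at h1
  exact h1

/-- The characteristic function of a normal scale mixture, in terms of the Laplace transform of the
mixing law. -/
theorem charFun_map_sqrt_mul_gaussian (M : Measure ℝ) [IsProbabilityMeasure M]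
    (hM : ∀ᵐ y ∂M, 0 ≤ y) (t : ℝ) :
    charFun ((M.prod (gaussianReal 0 1)).map fun p : ℝ × ℝ => √(2 * p.1) * p.2) t =
      ((∫ y, Real.exp (-(t ^ 2 * y)) ∂M : ℝ) : ℂ) := by
  have hm : Measurable fun p : ℝ × ℝ => √(2 * p.1) * p.2 := by fun_prop
  rw [charFun_apply_real, integral_map hm.aemeasurable (by fun_prop), integral_prod,
    ← integral_complex_ofReal]
  · refine integral_congr_ae ?_
    filter_upwards [hM] with y hy
    have h1 : charFun (gaussianReal 0 1) (√(2 * y) * t) =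
        ((Real.exp (-(t ^ 2 * y)) : ℝ) : ℂ) := by
      rw [charFun_gaussianReal]
      have : ((√(2 * y) * t : ℝ) : ℂ) ^ 2 = 2 * y * t ^ 2 := by
        rw [← Complex.ofReal_pow, mul_pow, Real.sq_sqrt (by positivity)]
        push_cast; ring
      rw [this]
      push_cast
      congr 1
      ring
    rw [← h1, charFun_apply_real]
    refine integral_congr_ae (ae_of_all _ fun z => ?_)
    simp only
    push_cast
    ring_nf
  · refine Integrable.of_bound (by fun_prop) 1 (ae_of_all _ fun p => ?_)
    rw [← Complex.ofReal_mul, Complex.norm_exp_ofReal_mul_I]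

/-! ### The equivalence -/

theorem theorem7
    (α ν : ℝ) (hα : 0 < α) (hα2 : α ≤ 2) (hν : 0 < ν)
    {Ω : Type*} [MeasurableSpace Ω] (P : Measure Ω) [IsProbabilityMeasure P]
    (X : ℕ → Ω → ℝ) (hXmeas : ∀ i, Measurable (X i))
    (hXindep : iIndepFun X P)
    (hXsq : ∀ i, MemLp (X i) 2 P)
    (hXmean : ∀ i, ∫ ω, X i ω ∂P = 0)
    (hXvar : ∀ i, 0 < variance (X i) P)
    (hLindeberg : LindebergCondition P X)
    (N : ℕ → Ω → ℕ) (hNmeas : ∀ n, Measurable (N n))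
    (hNindep : ∀ n, IndepFun (N n) (fun ω i => X i ω) P)
    (hNtop : TendstoInProbabilityAtTop P N)
    (d : ℕ → ℝ) (hdpos : ∀ n, 0 < d n) (hd : Tendsto d atTop atTop) :
    (∃ L : ProbabilityMeasure ℝ, IsGeneralizedLinnik α ν L ∧
      TendstoInDistribution (fun n ω => partialSum X (N n ω) ω / d n) atTop
        (fun x : ℝ => x) (fun _ => P) (L : Measure ℝ)) ↔
    (∃ M : ProbabilityMeasure ℝ, IsGeneralizedMittagLeffler (α / 2) ν M ∧
      TendstoInDistribution (fun n ω => varSum P X (N n ω) / d n ^ 2) atTop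
        (fun x : ℝ => 2 * x) (fun _ => P) (M : Measure ℝ)) := by
  have hSm : ∀ n, Measurable fun ω => partialSum X (N n ω) ω / d n := fun n =>
    (measurable_partialSum_comp hXmeas (hNmeas n)).div_const _
  have hVm : ∀ n, Measurable fun ω => varSum P X (N n ω) / d n ^ 2 := fun n =>
    ((measurable_of_countable (varSum P X)).comp (hNmeas n)).div_const _
  have hV0 : ∀ n ω, 0 ≤ varSum P X (N n ω) / d n ^ 2 := fun n ω =>
    div_nonneg (varSum_nonneg P X _) (sq_nonneg _)
  constructor
  · rintro ⟨L, hL, hconv⟩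
    have hbdd : ∀ ε : ℝ, 0 < ε → ∃ R : ℝ, ∀ᶠ n in atTop,
        P.real {ω | R < |varSum P X (N n ω) / d n ^ 2|} ≤ ε := fun ε hε =>
      exists_eventually_measureReal_lt_varSum_le hXmeas hXindep hXsq hXmean hXvar hLindeberg
        hNmeas hNindep hNtop hdpos (fun ε hε => hconv.exists_measureReal_lt_abs_le hε) hε
    have hlap : ∀ s : ℝ, 0 ≤ s → Tendsto
        (fun n => ∫ ω, Real.exp (-(s * (varSum P X (N n ω) / d n ^ 2))) ∂P) atTop
        (𝓝 (1 / (1 + (2 * s) ^ (α / 2)) ^ ν)) := by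
      intro s hs
      -- The frequency t = √(2s) makes t²/2 = s, so the characteristic functions reach every Laplace
      -- argument s ≥ 0.
      have h1 := tendsto_charFun_randomSum_sub_integral_exp hXmeas hXindep hXsq hXmean hXvar
        hLindeberg hNmeas hNindep hNtop hdpos hbdd √(2 * s)
      have h2 := ProbabilityMeasure.tendsto_iff_tendsto_charFun.1 hconv.tendsto √(2 * s)
      simp only [ProbabilityMeasure.coe_mk, Measure.map_id'] at h2
      rw [hL] at h2
      have h3 := h2.sub h1
      have h4 : |√(2 * s)| ^ α = (2 * s) ^ (α / 2) := by
        rw [abs_of_nonneg (Real.sqrt_nonneg _), Real.sqrt_eq_rpow,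
          ← Real.rpow_mul (by positivity)]
        congr 1; ring
      have h5 : √(2 * s) ^ 2 / 2 = s := by rw [Real.sq_sqrt (by positivity)]; ring
      simp only [sub_sub_cancel, sub_zero, h4, h5] at h3
      exact Filter.tendsto_ofReal_iff.1 h3
    let μ : ℕ → ProbabilityMeasure ℝ := fun n =>
      ⟨P.map fun ω => varSum P X (N n ω) / d n ^ 2,
        Measure.isProbabilityMeasure_map (hVm n).aemeasurable⟩
    obtain ⟨ρ, hρ0, hρ, hμρ⟩ := exists_tendsto_of_tendsto_integral_exp (ν := μ)
      (F := fun s => 1 / (1 + (2 * s) ^ (α / 2)) ^ ν)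
      (isTightMeasureSet_map_of_eventually_measureReal_le (fun n => (hVm n).aemeasurable) hbdd)
      (fun n => (ae_map_iff (hVm n).aemeasurable measurableSet_Ici).2 (ae_of_all _ (hV0 n)))
      (fun s hs => by
        refine (hlap s hs).congr fun n => ?_
        exact (integral_map (f := fun x : ℝ => Real.exp (-(s * x))) (hVm n).aemeasurable
          (by fun_prop)).symm)
    have hhalf : Measurable fun x : ℝ => x / 2 := by fun_prop
    let M : ProbabilityMeasure ℝ := ⟨(ρ : Measure ℝ).map fun x => x / 2,
      Measure.isProbabilityMeasure_map hhalf.aemeasurable⟩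
    refine ⟨M, ⟨?_, fun s hs => ?_⟩,
      fun n => (hVm n).aemeasurable, by fun_prop, ?_⟩
    · refine (ae_map_iff hhalf.aemeasurable measurableSet_Ici).2 ?_
      filter_upwards [hρ0] with x hx using div_nonneg hx two_pos.le
    · simp only [M, ProbabilityMeasure.coe_mk]
      rw [integral_map hhalf.aemeasurable (by fun_prop)]
      have := hρ (s / 2) (by positivity)
      rw [show 2 * (s / 2) = s by ring] at this
      rw [← this]
      congr 1 with x
      ring_nf
    · convert! hμρ using 2
      congr 1
      refine Subtype.ext ?_
      simp only [M, ProbabilityMeasure.coe_mk]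
      rw [Measure.map_map (by fun_prop) hhalf]
      have : ((fun x : ℝ => 2 * x) ∘ fun x => x / 2) = id := by ext x; simp; ring
      rw [this, Measure.map_id]
      rfl
  · rintro ⟨M, ⟨hM0, hM⟩, hconv⟩
    have hm : Measurable fun p : ℝ × ℝ => √(2 * p.1) * p.2 := by fun_prop
    have hlap : ∀ t : ℝ, ∫ y, Real.exp (-(t ^ 2 * y)) ∂(M : Measure ℝ)
        = 1 / (1 + |t| ^ α) ^ ν := by
      intro t
      rw [hM _ (sq_nonneg t), ← sq_abs, ← Real.rpow_natCast, ← Real.rpow_mul (abs_nonneg t)]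
      congr 4
      push_cast; ring
    -- The Linnik law is realised as that of √(2M)·Z with Z standard normal and independent of M.
    let L : ProbabilityMeasure ℝ :=
      ⟨((M : Measure ℝ).prod (gaussianReal 0 1)).map fun p : ℝ × ℝ => √(2 * p.1) * p.2,
        Measure.isProbabilityMeasure_map hm.aemeasurable⟩
    have hL : IsGeneralizedLinnik α ν L := fun t => by
      rw [← hlap t]
      exact charFun_map_sqrt_mul_gaussian M hM0 t
    refine ⟨L, hL, fun n => (hSm n).aemeasurable, by fun_prop, ?_⟩
    refine ProbabilityMeasure.tendsto_iff_tendsto_charFun.2 fun t => ?_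
    simp only [ProbabilityMeasure.coe_mk, Measure.map_id']
    rw [hL t, ← hlap t]
    have h1 := tendsto_charFun_randomSum_sub_integral_exp hXmeas hXindep hXsq hXmean hXvar
      hLindeberg hNmeas hNindep hNtop hdpos (fun ε hε =>
        let ⟨R, _, hR⟩ := hconv.exists_measureReal_lt_abs_le hε
        ⟨R, Eventually.of_forall hR⟩) t
    have h2 := hconv.tendsto_integral_exp_neg_mul (fun n => ae_of_all _ (hV0 n))
      (hM0.mono fun x hx => mul_nonneg two_pos.le hx) (s := t ^ 2 / 2) (by positivity)
    have h3 := h1.add ((Complex.continuous_ofReal.tendsto _).comp h2)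
    simp only [Function.comp_def, sub_add_cancel, zero_add] at h3
    convert! h3 using 7
    ring
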